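/- Let $n\ge 1$ be an integer and $q>2$ a prime power, let $F=GF(q)$ and $K=GF(q^{n+1})\supset F$, and regard $V=K\oplus K$ as a $(2n+2)$-dimensional vector space over $F$, so that the points of $PG(2n+1,q)$ are the one-dimensional $F$-subspaces of $V$. A collineation of $PG(2n+1,q)$ is a permutation of its points which, together with its inverse, maps lines to lines. Put $J(\infty)=\{(x,0):x\in K\}$ and $J(k)=\{(kx,x):x\in K\}$ for $k\in K$; these are $n$-dimensional subspaces of $PG(2n+1,q)$. Let $\mathcal S=\{J(\infty)\}\cup\{J(k):k\in K\}$ be the regular spread that they form. For $\rho\in\mathrm{Aut}(K)$ and $a,b,c,d\in K$ with $ad-bc\ne 0$, let $\chi_{a,b,c,d,\rho}$ be the permutation of the points of $PG(2n+1,q)$ induced by $$(x,y)\mapsto(ax^\rho+cy^\rho,\;bx^\rho+dy^\rho).$$ Then the group of all collineations of $PG(2n+1,q)$ that leave $\mathcal S$ invariant (that is, map the set $\mathcal S$ of subspaces onto itself) is exactly the set $$\{\chi_{a,b,c,d,\rho}:\rho\in\mathrm{Aut}(K),\ a,b,c,d\in K,\ ad-bc\neq 0\}.$$ -/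

import Mathlib

open scoped LinearAlgebra.Projectivization Pointwise

namespace RegularSpread

/-! ### Lines and collineations of a projective space -/

/-- A set of points of `ℙ F V` is a line if it is the set of points of a two-dimensional
linear subspace of `V`. -/
def IsLine {F V : Type*} [Field F] [AddCommGroup V] [Module F V] (L : Set (ℙ F V)) : Prop :=
  ∃ W : Submodule F V, Module.finrank F W = 2 ∧ L = (W.projectivization : Set (ℙ F V))

/-- The group of collineations of `ℙ F V`: the permutations of the points which map lines to
lines, and whose inverse does so too. -/
def collineationGroup (F V : Type*) [Field F] [AddCommGroup V] [Module F V] :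
    Subgroup (Equiv.Perm (ℙ F V)) where
  carrier := {g | ∀ L : Set (ℙ F V), IsLine (g '' L) ↔ IsLine L}
  mul_mem' {g h} hg hh L := by
    rw [Equiv.Perm.coe_mul, Set.image_comp]
    exact (hg _).trans (hh L)
  one_mem' L := by
    rw [Equiv.Perm.coe_one, Set.image_id]
  inv_mem' {g} hg L := by
    rw [← hg, ← Set.image_comp, ← Equiv.Perm.coe_mul, mul_inv_cancel, Equiv.Perm.coe_one,
      Set.image_id]

section

variable (F K : Type*) [Field F] [Field K] [Algebra F K]

/-! ### The spread `S` in the projective space of `K ⊕ K` over `F` -/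

/-- `J(∞) = {(x, 0) : x ∈ K}`, as an `F`-linear subspace of `K × K`. -/
def jInfty : Submodule F (K × K) where
  carrier := {v | ∃ x : K, v = (x, 0)}
  add_mem' := by
    rintro _ _ ⟨x, rfl⟩ ⟨y, rfl⟩
    exact ⟨x + y, by simp⟩
  zero_mem' := ⟨0, rfl⟩
  smul_mem' := by
    rintro f _ ⟨x, rfl⟩
    exact ⟨f • x, by simp⟩

/-- `J(k) = {(k x, x) : x ∈ K}`, as an `F`-linear subspace of `K × K`. -/
def jSpace (k : K) : Submodule F (K × K) where
  carrier := {v | ∃ x : K, v = (k * x, x)}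
  add_mem' := by
    rintro _ _ ⟨x, rfl⟩ ⟨y, rfl⟩
    exact ⟨x + y, by simp [mul_add]⟩
  zero_mem' := ⟨0, by rw [mul_zero]; rfl⟩
  smul_mem' := by
    rintro f _ ⟨x, rfl⟩
    exact ⟨f • x, by simp⟩

/-- `S = {J(∞)} ∪ {J(k) : k ∈ K}`, each member being regarded as a set of points of the
projective space. -/
def regularSpread : Set (Set (ℙ F (K × K))) :=
  {((jInfty F K).projectivization : Set (ℙ F (K × K)))} ∪
    {A | ∃ k : K, A = ((jSpace F K k).projectivization : Set (ℙ F (K × K)))}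

/-- The group of collineations of the projective space which leave `S` invariant. A permutation
`g` of the points acts on point sets by `A ↦ g '' A`, and `g` leaves `S` invariant if
`{g '' A | A ∈ S} = S`. -/
def spreadStabilizer : Subgroup (Equiv.Perm (ℙ F (K × K))) :=
  collineationGroup F (K × K) ⊓
    MulAction.stabilizer (Equiv.Perm (ℙ F (K × K))) (regularSpread F K)

end

/-! ### The transformations `χ` -/

/-- `(x, y) ↦ (a x^ρ + c y^ρ, b x^ρ + d y^ρ)` on vectors. -/
def chiVec {K : Type*} [Field K] (ρ : K ≃+* K) (a b c d : K) (v : K × K) : K × K :=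
  (a * ρ v.1 + c * ρ v.2, b * ρ v.1 + d * ρ v.2)

theorem chiVec_injective {K : Type*} [Field K] (ρ : K ≃+* K) {a b c d : K}
    (h : a * d - b * c ≠ 0) : Function.Injective (chiVec ρ a b c d) := by
  rintro ⟨x, y⟩ ⟨z, w⟩ e
  simp only [chiVec, Prod.mk.injEq] at e
  obtain ⟨e1, e2⟩ := e
  have hx : (a * d - b * c) * (ρ x - ρ z) = 0 := by linear_combination d * e1 - c * e2
  have hy : (a * d - b * c) * (ρ y - ρ w) = 0 := by linear_combination a * e2 - b * e1
  have hx' := sub_eq_zero.1 ((mul_eq_zero.1 hx).resolve_left h)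
  have hy' := sub_eq_zero.1 ((mul_eq_zero.1 hy).resolve_left h)
  rw [ρ.injective hx', ρ.injective hy']

theorem chiVec_ne_zero {K : Type*} [Field K] (ρ : K ≃+* K) {a b c d : K}
    (h : a * d - b * c ≠ 0) {v : K × K} (hv : v ≠ 0) : chiVec ρ a b c d v ≠ 0 := by
  intro e
  refine hv (chiVec_injective ρ h (e.trans ?_))
  simp only [chiVec, Prod.fst_zero, Prod.snd_zero, map_zero, mul_zero, add_zero]
  rfl

/-- An automorphism of a finite field `K` maps each subfield `F` into itself. -/
theorem exists_algebraMap_eq (F : Type*) {K : Type*} [Field F] [Finite F] [Field K] [Algebra F K]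
    (ρ : K ≃+* K) (f : F) : ∃ f' : F, algebraMap F K f' = ρ (algebraMap F K f) := by
  classical
  have := Fintype.ofFinite F
  have h1 : ((Polynomial.X ^ Fintype.card F - Polynomial.X : Polynomial F)).Splits := by
    rw [Polynomial.splits_iff_card_roots, FiniteField.roots_X_pow_card_sub_X, ← Finset.card_def,
      Finset.card_univ, FiniteField.X_pow_card_sub_X_natDegree_eq _ Fintype.one_lt_card]
  have h2 := h1.roots_map (algebraMap F K)
  have h3 : ρ (algebraMap F K f) ∈ ((Polynomial.X ^ Fintype.card F - Polynomial.X :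
      Polynomial F).map (algebraMap F K)).roots := by
    have h0 : (Polynomial.X ^ Fintype.card F - Polynomial.X : Polynomial F) ≠ 0 :=
      FiniteField.X_pow_card_sub_X_ne_zero F Fintype.one_lt_card
    rw [Polynomial.mem_roots (Polynomial.map_ne_zero h0)]
    simp [← map_pow, FiniteField.pow_card]
  rw [h2, Multiset.mem_map] at h3
  obtain ⟨f', -, hf'⟩ := h3
  exact ⟨f', hf'⟩

theorem exists_chiVec_smul (F : Type*) {K : Type*} [Field F] [Finite F] [Field K] [Algebra F K]
    (ρ : K ≃+* K) (f : F) : ∃ f' : F, ∀ (a b c d : K) (v : K × K),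
      chiVec ρ a b c d (f • v) = f' • chiVec ρ a b c d v := by
  obtain ⟨f', hf'⟩ := exists_algebraMap_eq F ρ f
  refine ⟨f', fun a b c d v => ?_⟩
  simp only [chiVec, Prod.smul_fst, Prod.smul_snd, Prod.smul_mk, Prod.mk.injEq]
  simp only [Algebra.smul_def, map_mul, hf']
  constructor <;> ring

/-- The map on points induced by `chiVec`. -/
def chiFun (F : Type*) {K : Type*} [Field F] [Finite F] [Field K] [Algebra F K]
    (ρ : K ≃+* K) (a b c d : K) (h : a * d - b * c ≠ 0) : ℙ F (K × K) → ℙ F (K × K) :=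
  Projectivization.lift
    (fun v => Projectivization.mk F (chiVec ρ a b c d v) (chiVec_ne_zero ρ h v.2)) (by
      rintro ⟨_, hv⟩ ⟨w, hw⟩ f rfl
      obtain ⟨f', hf'⟩ := exists_chiVec_smul F ρ f
      rw [Projectivization.mk_eq_mk_iff']
      exact ⟨f', (hf' a b c d w).symm⟩)

theorem chiFun_bijective (F : Type*) {K : Type*} [Field F] [Finite F] [Field K] [Finite K]
    [Algebra F K] (ρ : K ≃+* K) (a b c d : K) (h : a * d - b * c ≠ 0) :
    Function.Bijective (chiFun F ρ a b c d h) := by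
  have : Finite (ℙ F (K × K)) := Quotient.finite _
  refine Finite.injective_iff_bijective.1 fun p r e => ?_
  induction p using Projectivization.ind with | h v hv =>
  induction r using Projectivization.ind with | h w hw =>
  have e' := (Projectivization.mk_eq_mk_iff' F _ _ (chiVec_ne_zero ρ h hv)
    (chiVec_ne_zero ρ h hw)).1 e
  obtain ⟨f, hf⟩ := e'
  obtain ⟨f', hf'⟩ := exists_algebraMap_eq F ρ.symm f
  rw [Projectivization.mk_eq_mk_iff']
  refine ⟨f', chiVec_injective ρ h (Eq.trans ?_ hf)⟩
  simp only [chiVec, Prod.smul_fst, Prod.smul_snd, Prod.smul_mk, Prod.mk.injEq]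
  simp only [Algebra.smul_def, map_mul, hf', RingEquiv.apply_symm_apply]
  constructor <;> ring

/-- The transformation `χ` with parameters `a, b, c, d, ρ`, as a permutation of the points:
the point with homogeneous coordinates `(x, y)` is mapped to the point with homogeneous
coordinates `(a x^ρ + c y^ρ, b x^ρ + d y^ρ)`. -/
noncomputable def chi (F : Type*) {K : Type*} [Field F] [Finite F] [Field K] [Finite K]
    [Algebra F K] (ρ : K ≃+* K) (a b c d : K) (h : a * d - b * c ≠ 0) :
    Equiv.Perm (ℙ F (K × K)) :=
  Equiv.ofBijective (chiFun F ρ a b c d h) (chiFun_bijective F ρ a b c d h)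

theorem chi_mk (F : Type*) {K : Type*} [Field F] [Finite F] [Field K] [Finite K]
    [Algebra F K] (ρ : K ≃+* K) (a b c d : K) (h : a * d - b * c ≠ 0) (v : K × K) (hv : v ≠ 0) :
    chi F ρ a b c d h (Projectivization.mk F v hv) =
      Projectivization.mk F (a * ρ v.1 + c * ρ v.2, b * ρ v.1 + d * ρ v.2)
        (chiVec_ne_zero ρ h hv) :=
  rfl

end RegularSpread

/-! For a collineation `g` fixing the spread, the proof combines two facts. First, as the projective
dimension is at least two, `g` is induced by an additive map `T` of `K × K`
(`exists_addMonoidHom_mapsPoint`). This is the additive half of the fundamental theorem of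
projective geometry; semilinearity over `F` is never needed. Once a representative `v'` of the image
of `v` is fixed, each `u` off `⟨v⟩` has exactly one image representative `u'` with `v' - u'`
representing the image of `v - u`, and these choices fit together (`MapsSub.trans`).

Second, two points lie on a common spread member iff their coordinate vectors are `K`-proportional
(`mem_regularSpread_iff_det`), so `T` preserves `K`-dependence both ways. Hence `T (x, y) = f x • e₁
+ h y • e₂`, and comparing `(k * x, x)` with `(k, 1)` gives `f (k * x) = h x * f k`. So `h = f` is a
field automorphism and `T` is some `chiVec` (`exists_eq_chiVec`).

Conversely, each `chi` sends lines to lines and spread members to spread members; finiteness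
upgrades these inclusions to equalities. -/

namespace RegularSpread

/-! ### Independence of two and three vectors -/

section Independence

variable {F V : Type*} [Field F] [AddCommGroup V] [Module F V]

theorem eq_zero_of_smul_add_smul {v u : V} (hv : v ≠ 0) (hu : u ∉ Submodule.span F {v}) {a b : F}
    (h : a • v + b • u = 0) : a = 0 ∧ b = 0 := by
  have hb : b = 0 := by
    by_contra hb
    refine hu (Submodule.mem_span_singleton.2 ⟨-(b⁻¹ * a), ?_⟩)
    have h' : b⁻¹ • (a • v + b • u) = 0 := by rw [h, smul_zero]
    rw [smul_add, smul_smul b⁻¹ b, inv_mul_cancel₀ hb, one_smul] at h'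
    rw [eq_neg_of_add_eq_zero_right h', neg_smul, mul_smul]
  subst hb
  simpa [hv] using h

theorem eq_zero_of_smul_add_smul_add_smul {v u x : V} (hv : v ≠ 0)
    (hu : u ∉ Submodule.span F {v}) (hx : x ∉ Submodule.span F {v, u}) {a b c : F}
    (h : a • v + b • u + c • x = 0) : a = 0 ∧ b = 0 ∧ c = 0 := by
  have hc : c = 0 := by
    by_contra hc
    refine hx (Submodule.mem_span_pair.2 ⟨-(c⁻¹ * a), -(c⁻¹ * b), ?_⟩)
    have h' : c⁻¹ • (a • v + b • u + c • x) = 0 := by rw [h, smul_zero]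
    rw [smul_add, smul_smul c⁻¹ c, inv_mul_cancel₀ hc, one_smul] at h'
    rw [eq_neg_of_add_eq_zero_right h']
    module
  subst hc
  rw [zero_smul, add_zero] at h
  exact ⟨(eq_zero_of_smul_add_smul hv hu h).1, (eq_zero_of_smul_add_smul hv hu h).2, rfl⟩

theorem ne_zero_of_notMem_span {v : V} {s : Set V} (h : v ∉ Submodule.span F s) : v ≠ 0 :=
  fun e => h (e ▸ Submodule.zero_mem _)

theorem notMem_span_singleton_symm {v u : V} (hv : v ≠ 0) (hu : u ∉ Submodule.span F {v}) :
    v ∉ Submodule.span F {u} := by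
  intro h
  obtain ⟨a, rfl⟩ := Submodule.mem_span_singleton.1 h
  have ha : a ≠ 0 := fun e => hv (by rw [e, zero_smul])
  exact hu (Submodule.mem_span_singleton.2 ⟨a⁻¹, by rw [smul_smul, inv_mul_cancel₀ ha, one_smul]⟩)

theorem notMem_span_pair_exchange {v u x : V} (hu : u ∉ Submodule.span F {v})
    (hx : x ∉ Submodule.span F {v, u}) : u ∉ Submodule.span F {v, x} := by
  intro h
  rw [Set.pair_comm] at h
  have := _root_.mem_span_insert_exchange h hu
  rw [Set.pair_comm] at this
  exact hx this

theorem notMem_span_left {v u x : V} (hx : x ∉ Submodule.span F {v, u}) :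
    x ∉ Submodule.span F {v} :=
  fun h => hx (Submodule.span_mono (by simp) h)

theorem notMem_span_right {v u x : V} (hx : x ∉ Submodule.span F {v, u}) :
    x ∉ Submodule.span F {u} :=
  fun h => hx (Submodule.span_mono (by simp) h)

theorem finrank_span_pair {v u : V} (hv : v ≠ 0) (hu : u ∉ Submodule.span F {v}) :
    Module.finrank F (Submodule.span F {v, u}) = 2 := by
  have h : LinearIndependent F ![v, u] :=
    LinearIndependent.pair_iff.2 fun _ _ e => eq_zero_of_smul_add_smul hv hu e
  have := finrank_span_eq_card h
  rwa [Matrix.range_cons_cons_empty, Fintype.card_fin] at this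

theorem mk_eq_mk_iff_mem_span {v u : V} (hv : v ≠ 0) (hu : u ≠ 0) :
    Projectivization.mk F v hv = Projectivization.mk F u hu ↔ v ∈ Submodule.span F {u} := by
  rw [Projectivization.mk_eq_mk_iff', Submodule.mem_span_singleton]

theorem exists_notMem_span_pair (h : 2 < Module.finrank F V) (v u : V) :
    ∃ x, x ∉ Submodule.span F {v, u} := by
  by_contra! hx
  have htop : Submodule.span F {v, u} = ⊤ := Submodule.eq_top_iff'.2 hx
  classical
  have h2 := finrank_span_finset_le_card (R := F) ({v, u} : Finset V)
  rw [Finset.coe_pair, Set.finrank, htop, finrank_top] at h2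
  exact absurd (h2.trans Finset.card_le_two) (not_le.2 h)

end Independence

/-! ### Collineations are induced by additive maps -/

section Collineation

variable {F V : Type*} [Field F] [AddCommGroup V] [Module F V] {g : Equiv.Perm (ℙ F V)}

/-- The permutation `g` maps the point spanned by `v` to the point spanned by `w`. -/
def MapsPoint (g : Equiv.Perm (ℙ F V)) (v w : V) : Prop :=
  ∃ (hv : v ≠ 0) (hw : w ≠ 0), g (Projectivization.mk F v hv) = Projectivization.mk F w hw

theorem MapsPoint.exists_of_ne_zero (g : Equiv.Perm (ℙ F V)) {v : V} (hv : v ≠ 0) :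
    ∃ w, MapsPoint g v w :=
  ⟨(g (Projectivization.mk F v hv)).rep, hv, Projectivization.rep_nonzero _,
    (Projectivization.mk_rep _).symm⟩

theorem MapsPoint.inv {v w : V} (h : MapsPoint g v w) : MapsPoint g⁻¹ w v := by
  obtain ⟨hv, hw, h⟩ := h
  exact ⟨hw, hv, by rw [← h, Equiv.Perm.coe_inv, Equiv.symm_apply_apply]⟩

theorem MapsPoint.smul {v w : V} (h : MapsPoint g v w) {a b : F} (ha : a ≠ 0) (hb : b ≠ 0) :
    MapsPoint g (a • v) (b • w) := by
  obtain ⟨hv, hw, h⟩ := h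
  refine ⟨smul_ne_zero ha hv, smul_ne_zero hb hw, ?_⟩
  have h1 := (mk_eq_mk_iff_mem_span (F := F) (smul_ne_zero ha hv) hv).2
    (Submodule.smul_mem _ _ (Submodule.mem_span_singleton_self _))
  have h2 := (mk_eq_mk_iff_mem_span (F := F) (smul_ne_zero hb hw) hw).2
    (Submodule.smul_mem _ _ (Submodule.mem_span_singleton_self _))
  rw [h1, h2, h]

theorem MapsPoint.neg {v w : V} (h : MapsPoint g v w) : MapsPoint g (-v) (-w) := by
  simpa using h.smul (a := (-1 : F)) (b := -1) (by simp) (by simp)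

theorem MapsPoint.mem_span_singleton {v v' u u' : V} (hv : MapsPoint g v v')
    (hu : MapsPoint g u u') (h : u ∈ Submodule.span F {v}) : u' ∈ Submodule.span F {v'} := by
  obtain ⟨hv0, hv0', hv⟩ := hv
  obtain ⟨hu0, hu0', hu⟩ := hu
  rw [← mk_eq_mk_iff_mem_span hu0 hv0] at h
  rw [← mk_eq_mk_iff_mem_span hu0' hv0', ← hu, ← hv, h]

theorem MapsPoint.notMem_span_singleton {v v' u u' : V} (hv : MapsPoint g v v')
    (hu : MapsPoint g u u') (h : u ∉ Submodule.span F {v}) : u' ∉ Submodule.span F {v'} :=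
  fun h' => h (hv.inv.mem_span_singleton hu.inv h')

/-- The image of the line through `v` and `u` is a line containing the independent `v'` and `u'`,
hence is spanned by them. -/
theorem MapsPoint.mem_span_pair (hg : g ∈ collineationGroup F V) {v v' u u' x x' : V}
    (hv : MapsPoint g v v') (hu : MapsPoint g u u') (hx : MapsPoint g x x')
    (h : u ∉ Submodule.span F {v}) (hxm : x ∈ Submodule.span F {v, u}) :
    x' ∈ Submodule.span F {v', u'} := by
  have h' := hv.notMem_span_singleton hu h
  obtain ⟨hv0, hv0', hv⟩ := hv
  obtain ⟨hu0, hu0', hu⟩ := hu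
  obtain ⟨hx0, hx0', hx⟩ := hx
  obtain ⟨W, hW, hL⟩ := (hg _).2 ⟨_, finrank_span_pair hv0 h, rfl⟩
  have key : ∀ {y y' : V} (hy : y ≠ 0) (hy' : y' ≠ 0),
      g (Projectivization.mk F y hy) = Projectivization.mk F y' hy' →
      y ∈ Submodule.span F {v, u} → y' ∈ W := by
    intro y y' hy hy' e hm
    have : Projectivization.mk F y' hy' ∈ (W.projectivization : Set (ℙ F V)) := by
      rw [← hL, ← e]
      exact Set.mem_image_of_mem _ hm
    exact this
  have hWs : Submodule.span F {v', u'} = W := by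
    have : FiniteDimensional F W := Module.finite_of_finrank_pos (by omega)
    refine Submodule.eq_of_le_of_finrank_eq ?_ ((finrank_span_pair hv0' h').trans hW.symm)
    rw [Submodule.span_le, Set.insert_subset_iff, Set.singleton_subset_iff]
    exact ⟨key hv0 hv0' hv (Submodule.subset_span (by simp)),
      key hu0 hu0' hu (Submodule.subset_span (by simp))⟩
  rw [hWs]
  exact key hx0 hx0' hx hxm

theorem MapsPoint.notMem_span_pair (hg : g ∈ collineationGroup F V) {v v' u u' x x' : V}
    (hv : MapsPoint g v v') (hu : MapsPoint g u u') (hx : MapsPoint g x x')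
    (h : u ∉ Submodule.span F {v}) (hxm : x ∉ Submodule.span F {v, u}) :
    x' ∉ Submodule.span F {v', u'} :=
  fun h' => hxm (mem_span_pair (inv_mem hg) hv.inv hu.inv hx.inv
    (hv.notMem_span_singleton hu h) h')

/-- The images of the points `v`, `u`, `v - u` are the points `v'`, `u'`, `v' - u'`. -/
structure MapsSub (g : Equiv.Perm (ℙ F V)) (v v' u u' : V) : Prop where
  left : MapsPoint g v v'
  right : MapsPoint g u u'
  sub : MapsPoint g (v - u) (v' - u')

theorem MapsSub.symm {v v' u u' : V} (h : MapsSub g v v' u u') : MapsSub g u u' v v' :=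
  ⟨h.right, h.left, by simpa using h.sub.neg⟩

/-- With `u'' = c • u'` and `v' - u'' = e • (v' - u')`, comparing coefficients of the independent
`v'`, `u'` forces `e = 1` and `c = e`. -/
theorem MapsSub.unique {v v' u u' u'' : V} (hu : u ∉ Submodule.span F {v})
    (h : MapsSub g v v' u u') (h' : MapsSub g v v' u u'') : u' = u'' := by
  have hu' := h.left.notMem_span_singleton h.right hu
  obtain ⟨c, rfl⟩ := Submodule.mem_span_singleton.1
    (h.right.mem_span_singleton h'.right (Submodule.mem_span_singleton_self _))
  obtain ⟨e, he⟩ := Submodule.mem_span_singleton.1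
    (h.sub.mem_span_singleton h'.sub (Submodule.mem_span_singleton_self _))
  have := eq_zero_of_smul_add_smul (a := e - 1) (b := c - e) h.left.2.1 hu'
    (by linear_combination (norm := module) he)
  rw [sub_eq_zero, sub_eq_zero] at this
  rw [this.2, this.1, one_smul]

theorem MapsSub.exists (hg : g ∈ collineationGroup F V) {v v' u : V} (hv : MapsPoint g v v')
    (hu : u ∉ Submodule.span F {v}) : ∃ u', MapsSub g v v' u u' := by
  have hvu : v - u ∉ Submodule.span F {v} := fun h =>
    hu (by simpa using Submodule.sub_mem _ (Submodule.mem_span_singleton_self v) h)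
  have hvu' : v - u ∉ Submodule.span F {u} := fun h =>
    notMem_span_singleton_symm hv.1 hu
      (by simpa using Submodule.add_mem _ h (Submodule.mem_span_singleton_self u))
  obtain ⟨w, hw⟩ := MapsPoint.exists_of_ne_zero g (ne_zero_of_notMem_span hu)
  obtain ⟨y, hy⟩ := MapsPoint.exists_of_ne_zero g (ne_zero_of_notMem_span hvu)
  obtain ⟨a, b, rfl⟩ := Submodule.mem_span_pair.1 (hv.mem_span_pair hg hw hy hu
    (Submodule.sub_mem _ (Submodule.subset_span (by simp)) (Submodule.subset_span (by simp))))
  have ha : a ≠ 0 := by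
    rintro rfl
    exact hw.notMem_span_singleton hy hvu'
      (Submodule.mem_span_singleton.2 ⟨b, by simp⟩)
  have hb : b ≠ 0 := by
    rintro rfl
    exact hv.notMem_span_singleton hy hvu (Submodule.mem_span_singleton.2 ⟨a, by simp⟩)
  -- The image of `v - u` is spanned by `a • v' + b • w`; dividing by `a` makes the coefficient of
  -- `v'` equal to one.
  refine ⟨(-(a⁻¹ * b)) • w, hv, ?_, ?_⟩
  · simpa using hw.smul (a := (1 : F)) one_ne_zero
      (neg_ne_zero.2 (mul_ne_zero (inv_ne_zero ha) hb))
  · have := hy.smul (a := (1 : F)) one_ne_zero (inv_ne_zero ha)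
    rwa [one_smul, smul_add, smul_smul, smul_smul, inv_mul_cancel₀ ha, one_smul,
      ← sub_neg_eq_add, ← neg_smul] at this

/-- For independent `v`, `u`, `x`, the point `v - u` is where the line through `v`, `u` meets the
line through `v - x`, `x - u`. The image lines meet in the point `v' - u'`. -/
theorem MapsSub.trans (hg : g ∈ collineationGroup F V) {v v' u u' x x' : V}
    (hu : u ∉ Submodule.span F {v}) (hx : x ∉ Submodule.span F {v, u})
    (h : MapsSub g v v' x x') (h' : MapsSub g x x' u u') : MapsSub g v v' u u' := by
  refine ⟨h.left, h'.right, ?_⟩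
  have hv0 := h.left.1
  have hind := h.left.notMem_span_singleton h'.right hu
  have hind3 := h.left.notMem_span_pair hg h'.right h.right hu hx
  have hvu : v - u ≠ 0 := fun e => hu (by
    rw [← sub_eq_zero.1 e]; exact Submodule.mem_span_singleton_self v)
  obtain ⟨y, hy⟩ := MapsPoint.exists_of_ne_zero g hvu
  have hsub : x - u ∉ Submodule.span F {v - x} := by
    intro hm
    obtain ⟨a, ha⟩ := Submodule.mem_span_singleton.1 hm
    have := eq_zero_of_smul_add_smul_add_smul (a := a) (b := 1) (c := -a - 1) hv0 hu hx
      (by linear_combination (norm := module) ha)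
    exact one_ne_zero this.2.1
  obtain ⟨a, b, hab⟩ := Submodule.mem_span_pair.1 (h.left.mem_span_pair hg h'.right hy hu
    (Submodule.sub_mem _ (Submodule.subset_span (by simp)) (Submodule.subset_span (by simp))))
  obtain ⟨c, d, hcd⟩ := Submodule.mem_span_pair.1 (h.sub.mem_span_pair hg h'.sub hy hsub
    (Submodule.mem_span_pair.2 ⟨1, 1, by simp⟩))
  obtain ⟨h1, h2, h3⟩ := eq_zero_of_smul_add_smul_add_smul (a := c - a) (b := -d - b)
    (c := d - c) h.left.2.1 hind hind3 (by linear_combination (norm := module) hcd - hab)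
  have hca : c = a := sub_eq_zero.1 h1
  have hdc : d = c := sub_eq_zero.1 h3
  subst hdc hca
  have hc : d ≠ 0 := by
    rintro rfl
    exact hy.2.1 (by rw [← hcd]; simp)
  have hy' : y = d • (v' - u') := by rw [← hcd]; module
  have := hy.smul (a := (1 : F)) one_ne_zero (inv_ne_zero hc)
  rwa [hy', one_smul, smul_smul, inv_mul_cancel₀ hc, one_smul] at this

/-- A choice of images of all vectors which is compatible with subtraction, up to scalars. -/
theorem exists_mapsSub (hg : g ∈ collineationGroup F V) (hV : 2 < Module.finrank F V) :
    ∃ T : V → V, ∀ v u, v ≠ 0 → u ∉ Submodule.span F {v} → MapsSub g v (T v) u (T u) := by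
  obtain ⟨v₀, hv₀⟩ := exists_notMem_span_pair hV (0 : V) 0
  replace hv₀ := ne_zero_of_notMem_span hv₀
  obtain ⟨w₀, hw₀⟩ := MapsPoint.exists_of_ne_zero g hv₀
  obtain ⟨x₀, hx₀⟩ := exists_notMem_span_pair hV v₀ v₀
  replace hx₀ := notMem_span_left hx₀
  obtain ⟨y₀, hy₀⟩ := MapsSub.exists hg hw₀ hx₀
  have hx₀n := ne_zero_of_notMem_span hx₀
  have hsp : ∀ v ≠ 0, v ∈ Submodule.span F {v₀} →
      Submodule.span F {v} = Submodule.span F {v₀} := by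
    intro v hv h
    refine le_antisymm (by simpa using h) ?_
    by_contra h'
    exact notMem_span_singleton_symm hv (u := v₀) (by simpa using h') h
  -- Normalising against `v₀` says nothing about multiples of `v₀`, so those are normalised against
  -- the second base vector `x₀`.
  have hT : ∀ v, ∃ v', v ≠ 0 → (v ∉ Submodule.span F {v₀} → MapsSub g v₀ w₀ v v') ∧
      (v ∈ Submodule.span F {v₀} → MapsSub g x₀ y₀ v v') := by
    intro v
    by_cases hv : v = 0
    · exact ⟨0, fun h => (h hv).elim⟩
    by_cases h : v ∈ Submodule.span F {v₀}
    · have : v ∉ Submodule.span F {x₀} :=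
        notMem_span_singleton_symm hv (by rwa [hsp v hv h])
      obtain ⟨v', hv'⟩ := MapsSub.exists hg hy₀.right this
      exact ⟨v', fun _ => ⟨fun h' => (h' h).elim, fun _ => hv'⟩⟩
    · obtain ⟨v', hv'⟩ := MapsSub.exists hg hw₀ h
      exact ⟨v', fun _ => ⟨fun _ => hv', fun h' => (h h').elim⟩⟩
  choose T hT using hT
  -- The two normalisations agree at `x₀`, which can therefore link them.
  have hTx : T x₀ = y₀ := MapsSub.unique hx₀ ((hT x₀ hx₀n).1 hx₀) hy₀
  refine ⟨T, ?_⟩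
  -- `v`, `u` off `⟨v₀⟩` and `v₀` off `⟨v, u⟩`
  have mapsSub_of_notMem : ∀ v u, v ≠ 0 → u ∉ Submodule.span F {v} → v₀ ∉ Submodule.span F {v, u} →
      MapsSub g v (T v) u (T u) := by
    intro v u hv hu h0
    refine MapsSub.trans hg hu h0 ((hT v hv).1 ?_).symm ((hT u (ne_zero_of_notMem_span hu)).1 ?_)
    · exact notMem_span_singleton_symm hv (notMem_span_left h0)
    · exact notMem_span_singleton_symm (ne_zero_of_notMem_span hu) (notMem_span_right h0)
  -- `v`, `u` off `⟨v₀⟩`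
  have mapsSub_of_off : ∀ v u, v ≠ 0 → u ∉ Submodule.span F {v} → v ∉ Submodule.span F {v₀} →
      u ∉ Submodule.span F {v₀} → MapsSub g v (T v) u (T u) := by
    intro v u hv hu hv' hu'
    by_cases h0 : v₀ ∈ Submodule.span F {v, u}
    -- Here `v₀` is coplanar with `v`, `u` and cannot be the intermediate vector; an `x` outside
    -- that plane can.
    · obtain ⟨x, hx⟩ := exists_notMem_span_pair hV v u
      have hle : ∀ z ∈ ({v, u} : Set V), Submodule.span F {z, v₀} ≤ Submodule.span F {v, u} := by
        intro z hz
        rw [Submodule.span_le, Set.insert_subset_iff, Set.singleton_subset_iff]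
        exact ⟨Submodule.subset_span hz, h0⟩
      have hun := ne_zero_of_notMem_span hu
      have hvx : v₀ ∉ Submodule.span F {v, x} :=
        notMem_span_pair_exchange (notMem_span_singleton_symm hv₀ hv')
          (fun h => hx (hle v (by simp) h))
      have hux : v₀ ∉ Submodule.span F {u, x} :=
        notMem_span_pair_exchange (notMem_span_singleton_symm hv₀ hu')
          (fun h => hx (hle u (by simp) h))
      exact MapsSub.trans hg hu hx (mapsSub_of_notMem v x hv (notMem_span_left hx) hvx)
        (mapsSub_of_notMem u x hun (notMem_span_right hx) hux).symm
    · exact mapsSub_of_notMem v u hv hu h0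
  -- `v` on `⟨v₀⟩` and `u` off `⟨v, x₀⟩`
  have mapsSub_of_mem_of_notMem : ∀ v u, v ≠ 0 → v ∈ Submodule.span F {v₀} → u ∉ Submodule.span F {v, x₀} →
      MapsSub g v (T v) u (T u) := by
    intro v u hv hv' hu
    have hs := hsp v hv hv'
    have huv := notMem_span_left hu
    refine MapsSub.trans hg huv (notMem_span_pair_exchange (by rwa [hs]) hu)
      (hTx ▸ ((hT v hv).2 hv').symm) ?_
    exact mapsSub_of_off x₀ u hx₀n (notMem_span_right hu) hx₀ (by rwa [← hs])
  -- `v` on `⟨v₀⟩`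
  have mapsSub_of_mem : ∀ v u, v ≠ 0 → u ∉ Submodule.span F {v} → v ∈ Submodule.span F {v₀} →
      MapsSub g v (T v) u (T u) := by
    intro v u hv hu hv'
    by_cases h : u ∈ Submodule.span F {v, x₀}
    · have hs := hsp v hv hv'
      obtain ⟨y, hy⟩ := exists_notMem_span_pair hV v x₀
      have hle : Submodule.span F {v, u} ≤ Submodule.span F {v, x₀} := by
        rw [Submodule.span_le, Set.insert_subset_iff, Set.singleton_subset_iff]
        exact ⟨Submodule.subset_span (by simp), h⟩
      have hyu : y ∉ Submodule.span F {v, u} := fun h => hy (hle h)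
      have hun := ne_zero_of_notMem_span hu
      refine MapsSub.trans hg hu hyu (mapsSub_of_mem_of_notMem v y hv hv' hy) (mapsSub_of_off y u ?_ ?_ ?_ ?_)
      · exact ne_zero_of_notMem_span hy
      · exact notMem_span_singleton_symm hun (notMem_span_right hyu)
      · rw [← hs]; exact notMem_span_left hy
      · rwa [← hs]
    · exact mapsSub_of_mem_of_notMem v u hv hv' h
  intro v u hv hu
  by_cases hv' : v ∈ Submodule.span F {v₀}
  · exact mapsSub_of_mem v u hv hu hv'
  by_cases hu' : u ∈ Submodule.span F {v₀}
  · exact (mapsSub_of_mem u v (ne_zero_of_notMem_span hu) (notMem_span_singleton_symm hv hu) hu').symm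
  · exact mapsSub_of_off v u hv hu hv' hu'

/-- A collineation of a projective space of dimension at least two is induced by an additive map
of the underlying vector space. -/
theorem exists_addMonoidHom_mapsPoint (hg : g ∈ collineationGroup F V)
    (hV : 2 < Module.finrank F V) : ∃ T : V →+ V, ∀ v, v ≠ 0 → MapsPoint g v (T v) := by
  classical
  obtain ⟨T₀, hT₀⟩ := exists_mapsSub hg hV
  -- Nothing constrains `T₀ 0`, and additivity needs the value `0` there.
  let T : V → V := fun v => if v = 0 then 0 else T₀ v
  have hT0 : T 0 = 0 := if_pos rfl
  have hT : ∀ v u, v ≠ 0 → u ∉ Submodule.span F {v} → MapsSub g v (T v) u (T u) := by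
    intro v u hv hu
    simpa only [T, if_neg hv, if_neg (ne_zero_of_notMem_span hu)] using hT₀ v u hv hu
  -- Both sides represent the image of `v - u` and are normalised against `T v`, because `v - (v -
  -- u) = u`.
  have hsub : ∀ v u, v ≠ 0 → u ∉ Submodule.span F {v} → T (v - u) = T v - T u := by
    intro v u hv hu
    have hvu : v - u ∉ Submodule.span F {v} := fun h =>
      hu (by simpa using Submodule.sub_mem _ (Submodule.mem_span_singleton_self v) h)
    have h := hT v u hv hu
    refine MapsSub.unique hvu (hT v _ hv hvu) ⟨h.left, h.sub, ?_⟩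
    simpa using h.right
  have hex : ∀ v : V, ∃ x, x ≠ 0 ∧ x ∉ Submodule.span F {v} := by
    intro v
    obtain ⟨x, hx⟩ := exists_notMem_span_pair hV v v
    exact ⟨x, ne_zero_of_notMem_span hx, notMem_span_left hx⟩
  have hneg : ∀ u, T (-u) = - T u := by
    intro u
    by_cases hu0 : u = 0
    · simp [hu0, hT0]
    obtain ⟨x, hx0, hx⟩ := hex u
    have hu := notMem_span_singleton_symm hu0 hx
    have hxu : x ∉ Submodule.span F {x - u} := by
      refine notMem_span_singleton_symm hx0 fun h => hu ?_
      simpa using Submodule.sub_mem _ (Submodule.mem_span_singleton_self x) h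
    have hxu0 : x - u ≠ 0 := fun e => hx (by
      rw [sub_eq_zero.1 e]; exact Submodule.mem_span_singleton_self u)
    have := hsub _ _ hxu0 hxu
    rw [hsub x u hx0 hu] at this
    simpa using this
  have hsub' : ∀ v u, T (v - u) = T v - T u := by
    intro v u
    by_cases hv : v = 0
    · simp [hv, hT0, hneg]
    by_cases hu : u ∈ Submodule.span F {v}
    · by_cases hu0 : u = 0
      · simp [hu0, hT0]
      by_cases hvu : v = u
      · simp [hvu, hT0]
      -- For distinct proportional `v`, `u`, translating both by `-x` with `x` off their line makes
      -- them independent without changing the difference.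
      obtain ⟨x, hx0, hx⟩ := hex v
      have hxu : x ∉ Submodule.span F {u} := fun h =>
        hx ((Submodule.span_singleton_le_iff_mem _ _).2 hu h)
      have hvx := notMem_span_singleton_symm hv hx
      have hux := notMem_span_singleton_symm hu0 hxu
      have hvx0 : v - x ≠ 0 := fun e => hx (by
        rw [← sub_eq_zero.1 e]; exact Submodule.mem_span_singleton_self v)
      have hind : u - x ∉ Submodule.span F {v - x} := by
        intro h
        obtain ⟨c, rfl⟩ := Submodule.mem_span_singleton.1 hu
        obtain ⟨a, ha⟩ := Submodule.mem_span_singleton.1 h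
        have := eq_zero_of_smul_add_smul (a := a - c) (b := 1 - a) hv hx
          (by linear_combination (norm := module) ha)
        have h1 : (1 : F) = a := sub_eq_zero.1 this.2
        have h2 : a = c := sub_eq_zero.1 this.1
        exact hvu (by rw [← h2, ← h1, one_smul])
      have := hsub _ _ hvx0 hind
      rw [hsub v x hv hx, hsub u x hu0 hxu] at this
      simpa using this
    · exact hsub v u hv hu
  refine ⟨AddMonoidHom.ofMapSub T fun v u => hsub' v u, fun v hv => ?_⟩
  obtain ⟨x, -, hx⟩ := hex v
  exact (hT v x hv hx).left

end Collineation

/-! ### Members of the spread -/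

section Spread

variable {F K : Type*} [Field F] [Field K] [Algebra F K]

/-- Each nonzero vector spans a point on some member of the spread. -/
theorem exists_mem_regularSpread {v : K × K} (hv : v ≠ 0) :
    ∃ A ∈ regularSpread F K, Projectivization.mk F v hv ∈ A := by
  by_cases h : v.2 = 0
  · exact ⟨_, Or.inl rfl, v.1, Prod.ext rfl h⟩
  · exact ⟨_, Or.inr ⟨v.1 / v.2, rfl⟩, v.2, Prod.ext (div_mul_cancel₀ _ h).symm rfl⟩

/-- The member of the spread through a given point consists of the points spanned by the
`K`-multiples of the point. -/
theorem mem_regularSpread_iff_det {A : Set (ℙ F (K × K))} (hA : A ∈ regularSpread F K)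
    {v w : K × K} (hv : v ≠ 0) (hw : w ≠ 0) (hvA : Projectivization.mk F v hv ∈ A) :
    Projectivization.mk F w hw ∈ A ↔ v.1 * w.2 = v.2 * w.1 := by
  rcases hA with rfl | ⟨k, rfl⟩
  · obtain ⟨x, rfl⟩ := hvA
    have hx : x ≠ 0 := fun e => hv (by simp [e])
    refine Iff.trans (b := w.2 = 0) ⟨?_, fun h => ⟨w.1, Prod.ext rfl h⟩⟩ (by simp [hx])
    rintro ⟨y, rfl⟩
    rfl
  · obtain ⟨x, rfl⟩ := hvA
    have hx : x ≠ 0 := fun e => hv (by simp [e])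
    refine Iff.trans (b := w.1 = k * w.2) ⟨?_, fun h => ⟨w.2, Prod.ext h rfl⟩⟩ ?_
    · rintro ⟨y, rfl⟩
      rfl
    · constructor
      · intro h
        rw [h]; ring
      · intro h
        exact mul_left_cancel₀ hx (by linear_combination -h)

/-- Points on a common spread member go to points on a common member. The converse implication comes
from applying this to `g⁻¹`. -/
theorem det_map_eq_zero {g : Equiv.Perm (ℙ F (K × K))}
    (hg : g ∈ MulAction.stabilizer (Equiv.Perm (ℙ F (K × K))) (regularSpread F K))
    {v v' w w' : K × K} (hv : MapsPoint g v v') (hw : MapsPoint g w w')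
    (h : v.1 * w.2 = v.2 * w.1) : v'.1 * w'.2 = v'.2 * w'.1 := by
  obtain ⟨hv0, hv0', hv⟩ := hv
  obtain ⟨hw0, hw0', hw⟩ := hw
  obtain ⟨A, hA, hvA⟩ := exists_mem_regularSpread (F := F) hv0
  have hwA := (mem_regularSpread_iff_det hA hv0 hw0 hvA).2 h
  have hgA : g • A ∈ regularSpread F K := by
    rw [← MulAction.mem_stabilizer_iff.1 hg]
    exact Set.smul_mem_smul_set hA
  refine (mem_regularSpread_iff_det hgA hv0' hw0' ?_).1 ?_
  · rw [← hv]; exact Set.smul_mem_smul_set hvA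
  · rw [← hw]; exact Set.smul_mem_smul_set hwA

end Spread

/-! ### Additive maps which preserve the spread -/

theorem exists_smul_of_det {K : Type*} [Field K] {v w : K × K} (hv : v ≠ 0)
    (h : v.1 * w.2 = v.2 * w.1) : ∃ t : K, w = t • v := by
  by_cases h1 : v.1 = 0
  · have h2 : v.2 ≠ 0 := fun h2 => hv (Prod.ext h1 h2)
    refine ⟨w.2 / v.2, Prod.ext ?_ ?_⟩
    · have : w.1 = 0 := by simpa [h1, h2] using h
      simp [h1, this]
    · simp [h2]
  · refine ⟨w.1 / v.1, Prod.ext ?_ ?_⟩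
    · simp [h1]
    · simp only [Prod.smul_snd, smul_eq_mul]
      field_simp
      linear_combination h

/-- An additive injection of `K × K` which preserves `K`-linear dependence in both directions is
semilinear. -/
theorem exists_eq_chiVec {K : Type*} [Field K] [Finite K] (T : K × K →+ K × K)
    (hT0 : ∀ v, v ≠ 0 → T v ≠ 0)
    (hT : ∀ v w, v ≠ 0 → w ≠ 0 →
      (v.1 * w.2 = v.2 * w.1 ↔ (T v).1 * (T w).2 = (T v).2 * (T w).1)) :
    ∃ (ρ : K ≃+* K) (a b c d : K), a * d - b * c ≠ 0 ∧ ∀ v, T v = chiVec ρ a b c d v := by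
  set e₁ := T (1, 0) with he₁
  set e₂ := T (0, 1) with he₂
  have hdet : e₁.1 * e₂.2 - e₁.2 * e₂.1 ≠ 0 := by
    intro h
    have := (hT (1, 0) (0, 1) (by simp) (by simp)).2 (sub_eq_zero.1 h)
    simp at this
  have hlin : ∀ v w : K × K, v ≠ 0 → v.1 * w.2 = v.2 * w.1 → ∃ t : K, T w = t • T v := by
    intro v w hv h
    by_cases hw : w = 0
    · exact ⟨0, by simp [hw]⟩
    · exact exists_smul_of_det (hT0 v hv) ((hT v w hv hw).1 h)
  have hf : ∀ x : K, ∃ t : K, T (x, 0) = t • e₁ := fun x => hlin _ _ (by simp) (by simp)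
  have hh : ∀ x : K, ∃ t : K, T (0, x) = t • e₂ := fun x => hlin _ _ (by simp) (by simp)
  choose f hf using hf
  choose h hh using hh
  have hTfh : ∀ x y, T (x, y) = f x • e₁ + h y • e₂ := by
    intro x y
    rw [← hf, ← hh, ← map_add]
    simp
  have hind : ∀ {s t s' t' : K}, s • e₁ + t • e₂ = s' • e₁ + t' • e₂ → s = s' ∧ t = t' := by
    intro s t s' t' h
    have h1 := congrArg Prod.fst h
    have h2 := congrArg Prod.snd h
    simp only [Prod.fst_add, Prod.snd_add, Prod.smul_fst, Prod.smul_snd, smul_eq_mul] at h1 h2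
    constructor
    · exact mul_right_cancel₀ hdet (by linear_combination e₂.2 * h1 - e₂.1 * h2)
    · exact mul_right_cancel₀ hdet (by linear_combination e₁.1 * h2 - e₁.2 * h1)
  have hf1 : f 1 = 1 := (hind (t := 0) (t' := 0) (by rw [← hf, one_smul])).1
  have hh1 : h 1 = 1 := (hind (s := 0) (s' := 0) (by rw [← hh, one_smul])).2
  have hmul' : ∀ k x, f (k * x) = h x * f k := by
    intro k x
    -- As `h 1 = 1`, the `e₂`-coordinate shows that the factor `t` is `h x`.
    obtain ⟨t, ht⟩ := hlin (k, 1) (k * x, x) (by simp) (by simp)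
    rw [hTfh, hTfh, hh1, smul_add, smul_smul, smul_smul, mul_one] at ht
    rw [(hind ht).1, (hind ht).2]
  have hfh : ∀ x, h x = f x := fun x => by simpa [hf1] using (hmul' 1 x).symm
  have hadd : ∀ x y, f (x + y) = f x + f y := by
    intro x y
    refine (hind (t := 0) (t' := 0) ?_).1
    rw [add_smul, ← hf, ← hf, ← hf, ← map_add]
    simp
  have hf0 : f 0 = 0 := by simpa using hadd 0 0
  let φ : K →+* K :=
    { toFun := f
      map_one' := hf1
      map_mul' := fun x y => by rw [hmul', hfh, mul_comm]
      map_zero' := hf0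
      map_add' := hadd }
  refine ⟨RingEquiv.ofBijective φ (Finite.injective_iff_bijective.1 φ.injective),
    e₁.1, e₁.2, e₂.1, e₂.2, hdet, fun v => ?_⟩
  refine (hTfh v.1 v.2).trans (Prod.ext ?_ ?_)
  · change f v.1 * e₁.1 + h v.2 * e₂.1 = e₁.1 * f v.1 + e₂.1 * f v.2
    rw [hfh]; ring
  · change f v.1 * e₁.2 + h v.2 * e₂.2 = e₁.2 * f v.1 + e₂.2 * f v.2
    rw [hfh]; ring

/-! ### The transformations `χ` leave the spread invariant -/

section Chi

variable {F K : Type*} [Field F] [Finite F] [Field K] [Finite K] [Algebra F K]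

/-- Counting replaces any computation with the inverse of `chi`, for the set of lines as well as for
the spread. -/
theorem smul_set_eq_of_subset {G α : Type*} [Group G] [MulAction G α] [Finite α] {g : G}
    {s : Set α} (h : ∀ x ∈ s, g • x ∈ s) : g • s = s := by
  refine Set.eq_of_subset_of_ncard_le ?_ (Set.ncard_smul_set g s).ge s.toFinite
  rintro _ ⟨x, hx, rfl⟩
  exact h x hx

theorem exists_finrank_eq_image_chi (ρ : K ≃+* K) (a b c d : K) (h : a * d - b * c ≠ 0)
    (W : Submodule F (K × K)) :
    ∃ W' : Submodule F (K × K), Module.finrank F W' = Module.finrank F W ∧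
      chi F ρ a b c d h '' (W.projectivization : Set (ℙ F (K × K))) =
        (W'.projectivization : Set (ℙ F (K × K))) := by
  let W' : Submodule F (K × K) :=
    { carrier := chiVec ρ a b c d '' W
      add_mem' := by
        rintro _ _ ⟨v, hv, rfl⟩ ⟨w, hw, rfl⟩
        refine ⟨v + w, W.add_mem hv hw, ?_⟩
        ext <;> simp [chiVec] <;> ring
      zero_mem' := ⟨0, W.zero_mem, by ext <;> simp [chiVec]⟩
      smul_mem' := by
        rintro f _ ⟨v, hv, rfl⟩
        -- A scalar `f` outside `chiVec` is `ρ⁻¹ f` inside, which lies in `F` again.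
        obtain ⟨f', hf'⟩ := exists_algebraMap_eq F ρ.symm f
        refine ⟨f' • v, W.smul_mem _ hv, ?_⟩
        ext <;> simp [chiVec, Algebra.smul_def, hf'] <;> ring }
  have hmem : ∀ v, chiVec ρ a b c d v ∈ W' ↔ v ∈ W := fun v =>
    (chiVec_injective ρ h).mem_set_image
  refine ⟨W', ?_, ?_⟩
  -- `chiVec` need not be `F`-linear, so dimensions are compared by counting vectors.
  · have hc : Nat.card W' = Nat.card W :=
      Nat.card_image_of_injective (chiVec_injective ρ h) (W : Set (K × K))
    rw [Module.natCard_eq_pow_finrank (K := F) (V := W'),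
      Module.natCard_eq_pow_finrank (K := F) (V := W)] at hc
    exact Nat.pow_right_injective Finite.one_lt_card hc
  · ext p
    induction p using Projectivization.ind with | h w hw =>
    constructor
    · rintro ⟨p, hp, e⟩
      induction p using Projectivization.ind with | h v hv =>
      rw [← e, chi_mk]
      exact (hmem v).2 hp
    · rintro ⟨v, hv, rfl⟩
      have hv0 : v ≠ 0 := by
        rintro rfl
        exact hw (by ext <;> simp [chiVec])
      exact ⟨Projectivization.mk F v hv0, hv, rfl⟩

theorem chi_mem_collineationGroup (ρ : K ≃+* K) (a b c d : K) (h : a * d - b * c ≠ 0) :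
    chi F ρ a b c d h ∈ collineationGroup F (K × K) := by
  have : Finite (ℙ F (K × K)) := Quotient.finite _
  have key : chi F ρ a b c d h • {L : Set (ℙ F (K × K)) | IsLine L} = {L | IsLine L} := by
    refine smul_set_eq_of_subset ?_
    rintro _ ⟨W, hW, rfl⟩
    obtain ⟨W', hW', e⟩ := exists_finrank_eq_image_chi ρ a b c d h W
    exact ⟨W', hW'.trans hW, e⟩
  intro L
  have := Set.smul_mem_smul_set_iff (a := chi F ρ a b c d h)
    (s := {L : Set (ℙ F (K × K)) | IsLine L}) (x := L)
  rwa [key] at this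

/-- `chiVec` applies `ρ` to the determinant of two vectors and multiplies it by `a * d - b * c`, so
its vanishing, which describes the spread members, is preserved both ways. -/
theorem chi_mem_stabilizer (ρ : K ≃+* K) (a b c d : K) (h : a * d - b * c ≠ 0) :
    chi F ρ a b c d h ∈
      MulAction.stabilizer (Equiv.Perm (ℙ F (K × K))) (regularSpread F K) := by
  have : Finite (ℙ F (K × K)) := Quotient.finite _
  rw [MulAction.mem_stabilizer_iff]
  refine smul_set_eq_of_subset fun A hA => ?_
  have hex : ∃ (v : K × K) (hv : v ≠ 0), Projectivization.mk F v hv ∈ A := by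
    rcases hA with rfl | ⟨k, rfl⟩
    · exact ⟨(1, 0), by simp, 1, rfl⟩
    · exact ⟨(k, 1), by simp, 1, by simp⟩
  obtain ⟨v, hv, hvA⟩ := hex
  obtain ⟨B, hB, hvB⟩ := exists_mem_regularSpread (F := F) (chiVec_ne_zero ρ h hv)
  suffices e : chi F ρ a b c d h • A = B by rwa [e]
  have hmem : ∀ p, chi F ρ a b c d h p ∈ B ↔ p ∈ A := by
    intro p
    induction p using Projectivization.ind with | h w hw =>
    rw [mem_regularSpread_iff_det hA hv hw hvA]
    refine (mem_regularSpread_iff_det hB _ (chiVec_ne_zero ρ h hw) hvB).trans ?_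
    rw [← ρ.injective.eq_iff (a := v.1 * w.2), map_mul, map_mul, ← sub_eq_zero,
      ← sub_eq_zero (a := ρ v.1 * ρ w.2)]
    have : (chiVec ρ a b c d v).1 * (chiVec ρ a b c d w).2 -
        (chiVec ρ a b c d v).2 * (chiVec ρ a b c d w).1 =
        (a * d - b * c) * (ρ v.1 * ρ w.2 - ρ v.2 * ρ w.1) := by
      simp only [chiVec]; ring
    rw [this, mul_eq_zero, or_iff_right h]
  ext p
  obtain ⟨r, rfl⟩ := (chi F ρ a b c d h).surjective p
  rw [hmem]
  exact Set.smul_mem_smul_set_iff (a := chi F ρ a b c d h)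

end Chi

end RegularSpread

theorem proposition2p1 (n q : ℕ) (hn : 1 ≤ n) (hq : 2 < q)
    (F K : Type*) [Field F] [Finite F] [Field K] [Finite K] [Algebra F K]
    (hF : Nat.card F = q) (hK : Nat.card K = q ^ (n + 1)) :
    (RegularSpread.spreadStabilizer F K : Set (Equiv.Perm (ℙ F (K × K)))) =
      {g | ∃ (ρ : K ≃+* K) (a b c d : K) (h : a * d - b * c ≠ 0),
        g = RegularSpread.chi F ρ a b c d h} := by
  ext g
  constructor
  · rintro ⟨hg, hS⟩
    -- Counting gives `[K : F] = n + 1`, so the rank is `2 * (n + 1)`, at least four.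
    have hrank : 2 < Module.finrank F (K × K) := by
      have h := Module.natCard_eq_pow_finrank (K := F) (V := K)
      rw [hF, hK] at h
      have := Nat.pow_right_injective (by omega : 2 ≤ q) h
      rw [Module.finrank_prod]
      omega
    obtain ⟨T, hT⟩ := RegularSpread.exists_addMonoidHom_mapsPoint hg hrank
    obtain ⟨ρ, a, b, c, d, h, hρ⟩ := RegularSpread.exists_eq_chiVec T
      (fun v hv => (hT v hv).2.1) fun v w hv hw =>
        ⟨RegularSpread.det_map_eq_zero hS (hT v hv) (hT w hw),
          RegularSpread.det_map_eq_zero (inv_mem hS) (hT v hv).inv (hT w hw).inv⟩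
    refine ⟨ρ, a, b, c, d, h, Equiv.ext fun p => ?_⟩
    induction p using Projectivization.ind with | h v hv =>
    obtain ⟨_, hv', e⟩ := hT v hv
    rw [e, RegularSpread.chi_mk]
    congr 1
    exact hρ v
  · rintro ⟨ρ, a, b, c, d, h, rfl⟩
    exact ⟨RegularSpread.chi_mem_collineationGroup ρ a b c d h,
      RegularSpread.chi_mem_stabilizer ρ a b c d h⟩
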